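/- There is an absolute constant $K$ such that for every $\varepsilon>0$ there is a deterministic non-clairvoyant online algorithm with the following guarantees. An instance consists of $m$ identical machines and $n$ malleable jobs, all available at time $0$. Job $j$ has a speed-up function $f_j\colon\mathbb R_{\ge 0}\to\mathbb R_{\ge 0}$ that is non-decreasing, concave, and piecewise linear with breakpoints only at integers, a predicted processing requirement $\hat p_j>0$, and an actual processing requirement $p_j\ge \hat p_j$ (all jobs are underpredicted). In a feasible schedule, $x_{ij}(t)\ge 0$ is the fraction of machine $i$ given to job $j$ at time $t$, with $\sum_j x_{ij}(t)\le 1$ for all $i$ and $t$. Job $j$ is then processed at rate $f_j(\sum_i x_{ij}(t))$ and completes at the earliest time $C_j$ by which it has received $p_j$ units of processing. Let $\mathrm{OPT}$ be the infimum of $\sum_j C_j$ over all feasible schedules, chosen with knowledge of all data. The algorithm knows $m$, $n$, all $f_j$ and all $\hat p_j$, but not the $p_j$: its decision at time $t$ depends only on these data and on which jobs have completed by each time $s\le t$. It produces an integral schedule, in which each machine works on at most one job at a time and the assignment is piecewise constant in time. A preemption of job $j$ is a time before its completion at which the nonempty set of machines working on $j$ changes (that is, $j$ is interrupted or reallocated).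 On every instance, 1. the algorithm is $54(1+\varepsilon)$-competitive: $\sum_j C_j\le 54(1+\varepsilon)\,\mathrm{OPT}$; 2. the total number of preemptions is at most $$K\cdot\max\{1,\varepsilon^{-2}\}\cdot\sum_{j=1}^n\Bigl(1+\log_2\frac{p_j}{\hat p_j}\Bigr).$$ -/

import Mathlib

open scoped ENNReal Topology

namespace Malleable

/-- The data of an instance with `m` identical machines and `n` jobs that a non-clairvoyant
scheduler knows in advance: the speed-up functions (only their values on `[0, ∞)` matter) and the
predicted processing requirements. -/
structure Input (m n : ℕ) where
  /-- `speedup j x` is the processing rate of job `j` when it holds `x` machines in total. -/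
  speedup : Fin n → ℝ → ℝ
  /-- predicted processing requirement -/
  pred : Fin n → ℝ
  pred_pos : ∀ j, 0 < pred j
  speedup_nonneg : ∀ j, ∀ x, 0 ≤ x → 0 ≤ speedup j x
  speedup_mono : ∀ j, MonotoneOn (speedup j) (Set.Ici 0)
  speedup_concave : ∀ j, ConcaveOn ℝ (Set.Ici 0) (speedup j)
  /-- piecewise linear with breakpoints at integers: affine between consecutive integers -/
  speedup_affine : ∀ j, ∀ k : ℕ, ∃ a b : ℝ,
    ∀ x ∈ Set.Icc (k : ℝ) (k + 1), speedup j x = a * x + b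

/-- An allocation: `x t i j` is the fraction of machine `i` given to job `j` at time `t`. -/
abbrev Allocation (m n : ℕ) := ℝ → Fin m → Fin n → ℝ

/-- A feasible (fractional, arbitrarily preemptive) schedule. -/
structure FractionalSchedule (m n : ℕ) where
  alloc : Allocation m n
  measurable : ∀ i j, Measurable fun t => alloc t i j
  nonneg : ∀ t i j, 0 ≤ alloc t i j
  sum_le_one : ∀ t i, ∑ j, alloc t i j ≤ 1

/-- An integral schedule: at every time each machine works on at most one job
(`none` means that it idles). The assignment is piecewise constant and right-continuous, with
finitely many changes in every bounded time interval. -/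
structure Schedule (m n : ℕ) where
  assign : ℝ → Fin m → Option (Fin n)
  right_const : ∀ t, 0 ≤ t → ∀ᶠ s in 𝓝[>] t, assign s = assign t
  left_const : ∀ t, 0 < t → ∃ a, ∀ᶠ s in 𝓝[<] t, assign s = a

namespace Schedule

variable {m n : ℕ}

/-- The allocation with values in `{0, 1}` that belongs to an integral schedule. -/
def alloc (S : Schedule m n) : Allocation m n :=
  fun t i j => if S.assign t i = some j then 1 else 0

/-- The set of machines that work on job `j` at time `t`. -/
def machines (S : Schedule m n) (j : Fin n) (t : ℝ) : Set (Fin m) :=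
  {i | S.assign t i = some j}

/-- Job `j` runs on a nonempty set of machines right before time `t`, and from time `t` on it no
longer runs on exactly this set: it is interrupted or reallocated at time `t`. -/
def InterruptedAt (S : Schedule m n) (j : Fin n) (t : ℝ) : Prop :=
  ∃ A : Set (Fin m), A.Nonempty ∧ (∀ᶠ s in 𝓝[<] t, S.machines j s = A) ∧ S.machines j t ≠ A

end Schedule

namespace Input

variable {m n : ℕ}

/-- The amount of processing that job `j` receives in the time interval `[0, t]`. -/
noncomputable def processed (I : Input m n) (x : Allocation m n) (j : Fin n) (t : ℝ) : ℝ :=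
  ∫ s in (0 : ℝ)..t, I.speedup j (∑ i, x s i j)

/-- The completion time of job `j`, when its processing requirement is `p j`: the earliest time by
which it has received this amount of processing (`∞` if there is none). -/
noncomputable def completionTime (I : Input m n) (p : Fin n → ℝ) (x : Allocation m n)
    (j : Fin n) : ℝ≥0∞ :=
  ⨅ (t : ℝ) (_ : 0 ≤ t ∧ p j ≤ I.processed x j t), ENNReal.ofReal t

/-- The objective `∑ j, C j`. -/
noncomputable def totalCompletionTime (I : Input m n) (p : Fin n → ℝ) (x : Allocation m n) :
    ℝ≥0∞ :=
  ∑ j, I.completionTime p x j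

/-- The offline optimum, over all feasible fractional schedules. -/
noncomputable def opt (I : Input m n) (p : Fin n → ℝ) : ℝ≥0∞ :=
  ⨅ X : FractionalSchedule m n, I.totalCompletionTime p X.alloc

/-- All jobs are underpredicted. -/
def Underpredicted (I : Input m n) (p : Fin n → ℝ) : Prop :=
  ∀ j, I.pred j ≤ p j

/-- The total number of preemptions: the number of pairs of a job and a time, before the
completion of the job, at which the running job is interrupted or reallocated. -/
noncomputable def preemptions (I : Input m n) (p : Fin n → ℝ) (S : Schedule m n) : ℕ∞ :=
  ∑ j, {t : ℝ | 0 < t ∧ ENNReal.ofReal t < I.completionTime p S.alloc j ∧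
    S.InterruptedAt j t}.encard

/-- The benchmark `∑ j, (1 + log₂ (p j / p̂ j))`. -/
noncomputable def benchmark (I : Input m n) (p : Fin n → ℝ) : ℝ :=
  ∑ j, (1 + Real.logb 2 (p j / I.pred j))

end Input

/-- A deterministic non-clairvoyant online algorithm with predictions. For every known input it
maps the hidden processing requirements `p` to a schedule, whose assignment at time `t` depends
only on the input and on which jobs have completed by time `s`, for the times `s ≤ t`. -/
structure OnlineAlgorithm where
  run : ∀ {m n : ℕ}, Input m n → (Fin n → ℝ) → Schedule m n
  nonanticipating : ∀ {m n : ℕ} (I : Input m n) (p p' : Fin n → ℝ),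
    I.Underpredicted p → I.Underpredicted p' → ∀ t : ℝ, 0 ≤ t →
    (∀ s ∈ Set.Icc 0 t, ∀ j,
      (p j ≤ I.processed (run I p).alloc j s ↔ p' j ≤ I.processed (run I p').alloc j s)) →
    (run I p).assign t = (run I p').assign t

/-- The algorithm is `c`-competitive on all inputs with underpredicted jobs. -/
def OnlineAlgorithm.IsCompetitive (A : OnlineAlgorithm) (c : ℝ) : Prop :=
  ∀ (m n : ℕ) (I : Input m n) (p : Fin n → ℝ), I.Underpredicted p →
    I.totalCompletionTime p (A.run I p).alloc ≤ ENNReal.ofReal c * I.opt p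

end Malleable

/-! One algorithm, `geometricSharing`, serves every ε: it is 54-competitive with at most `4 *
benchmark` preemptions.

Time is cut into epochs whose starting times double. With N jobs alive at the start of an epoch,
each is entitled to an average of `share m N` machines, which is at least m / (2N). An active job
realises its share by running in a single slot of the epoch on a block of machines; nothing is
reassigned before the slot ends, even if the job completes. Hence a job is preempted at most once
per epoch in which it is active.

To make such epochs few, a job stays inactive until its `ideal` amount, what it would have had by
always receiving its share, passes half its prediction. The delay costs at most `pred / 2`, so a job
still alive has ideal amount at most 3p/2 (`ideal_le_of_mem_alive`). Shares grow as jobs finish, so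
ideal amounts at least double per epoch (`two_mul_ideal_le`), and between pred/2 and 3p/2 there is
room for only O(1 + log₂(p / pred)) epochs.

For the competitive ratio, offline time s is compared with online time 12s, and a machine at offline
time s is priced at 2N/m, where N is the number of jobs alive in the epoch of 12s. By concavity, a
job holding x machines offline runs at most 1 + x · price times as fast as at its online share. So a
job alive at the start of an epoch has paid for that start in offline time or in machines
(`start_le_payment`). All m machines together cost 2N, and integrating over time bounds the total
payment by a third of the summed last epoch starts (`sum_payment_le`). Half of that sum S is thus
absorbed: S ≤ 27/2 · T + S/2 for total offline time T, and completion within one more doubling gives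
54 T. -/

namespace Malleable

/-! ### Shares, slots and blocks of machines -/

/-- The number of machines that a running job receives when `N` jobs are alive. -/
def machinesPerJob (m N : ℕ) : ℕ := max 1 (m / max 1 N)

/-- The number of time slots into which an epoch is divided when `N` jobs are alive. -/
def slots (m N : ℕ) : ℕ := (max 1 N - 1) / m + 1

/-- The average number of machines that an active job holds when `N` jobs are alive. -/
noncomputable def share (m N : ℕ) : ℝ := machinesPerJob m N / slots m N

lemma machinesPerJob_pos (m N : ℕ) : 0 < machinesPerJob m N := by
  unfold machinesPerJob; omega

lemma slots_pos (m N : ℕ) : 0 < slots m N := Nat.succ_pos _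

lemma share_pos (m N : ℕ) : 0 < share m N := by
  have := machinesPerJob_pos m N
  have := slots_pos m N
  unfold share; positivity

lemma share_antitone (m : ℕ) : Antitone (share m) := by
  intro N N' h
  have h1 : machinesPerJob m N' ≤ machinesPerJob m N :=
    max_le_max le_rfl (Nat.div_le_div_left (max_le_max le_rfl h) (by omega))
  have h2 : slots m N ≤ slots m N' :=
    Nat.succ_le_succ (Nat.div_le_div_right (by omega))
  have := slots_pos m N
  unfold share
  gcongr

lemma machinesPerJob_eq_one_or_slots_eq_one {m : ℕ} (hm : 0 < m) (N : ℕ) :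
    machinesPerJob m N = 1 ∨ slots m N = 1 := by
  rcases Nat.lt_or_ge m (max 1 N) with h | h
  · left; unfold machinesPerJob; rw [Nat.div_eq_of_lt h]; rfl
  · right; unfold slots; rw [Nat.div_eq_of_lt (by omega)]

lemma share_le {m : ℕ} (hm : 0 < m) (N : ℕ) : share m N ≤ m := by
  have h1 : machinesPerJob m N ≤ m := max_le hm (Nat.div_le_self _ _)
  have h2 : (1 : ℝ) ≤ slots m N := by exact_mod_cast slots_pos m N
  have h3 : (machinesPerJob m N : ℝ) ≤ m := by exact_mod_cast h1
  unfold share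
  exact (div_le_self (by positivity) h2).trans h3

/-- Rounding to whole machines and whole slots costs at most a factor 2 against the fair share m /
N; only one of the two roundings occurs at a time. -/
lemma inv_share_le {m N : ℕ} (hm : 0 < m) (hN : 0 < N) : 1 / share m N ≤ 2 * N / m := by
  have hg := machinesPerJob_pos m N
  have key : m * slots m N ≤ 2 * N * machinesPerJob m N := by
    have hN1 : max 1 N = N := by omega
    unfold slots machinesPerJob
    rw [hN1]
    rcases Nat.lt_or_ge m N with h | h
    · have h1 := Nat.mul_div_le (N - 1) m
      have h2 : 1 ≤ max 1 (m / N) := le_max_left _ _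
      calc m * ((N - 1) / m + 1) = m * ((N - 1) / m) + m := by ring
        _ ≤ 2 * N := by omega
        _ ≤ 2 * N * max 1 (m / N) := Nat.le_mul_of_pos_right _ h2
    · rw [Nat.div_eq_of_lt (by omega)]
      have h1 : 1 ≤ m / N := (Nat.one_le_div_iff hN).2 h
      rw [max_eq_right h1]
      have h2 := Nat.lt_mul_div_succ m hN
      nlinarith
  have key' : (m : ℝ) * slots m N ≤ 2 * N * machinesPerJob m N := by exact_mod_cast key
  have hg' : (0 : ℝ) < machinesPerJob m N := by exact_mod_cast hg
  have hm' : (0 : ℝ) < m := by exact_mod_cast hm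
  unfold share
  rw [one_div_div, div_le_div_iff₀ hg' hm']
  linarith

lemma block_le {m N r : ℕ} (hm : 0 < m) (hr : r < N) :
    (r % m + 1) * machinesPerJob m N ≤ m := by
  have hN1 : max 1 N = N := by omega
  unfold machinesPerJob
  rw [hN1]
  have h0 := Nat.mod_lt r hm
  rcases Nat.lt_or_ge m N with h | h
  · rw [Nat.div_eq_of_lt h]; simp; omega
  · have h1 : 1 ≤ m / N := (Nat.one_le_div_iff (by omega)).2 h
    rw [max_eq_right h1, Nat.mod_eq_of_lt (by omega)]
    calc (r + 1) * (m / N) ≤ N * (m / N) := by gcongr; omega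
      _ ≤ m := Nat.mul_div_le _ _

lemma div_lt_slots {m N r : ℕ} (hr : r < N) : r / m < slots m N :=
  Nat.lt_succ_of_le (Nat.div_le_div_right (by omega))

lemma card_block {m g q : ℕ} (hg : 0 < g) (h : (q + 1) * g ≤ m) :
    (Finset.univ.filter fun i : Fin m => (i : ℕ) / g = q).card = g := by
  have : (Finset.univ.filter fun i : Fin m => (i : ℕ) / g = q).map Fin.valEmbedding =
      Finset.Ico (q * g) ((q + 1) * g) := by
    ext a
    simp only [Finset.mem_map, Finset.mem_filter, Finset.mem_univ, true_and,
      Fin.valEmbedding_apply, Finset.mem_Ico]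
    have e : a / g = q ↔ q * g ≤ a ∧ a < (q + 1) * g := by
      rw [Nat.div_eq_iff hg, add_mul]; omega
    constructor
    · rintro ⟨i, hi, rfl⟩; exact e.1 hi
    · intro ha; exact ⟨⟨a, by omega⟩, e.2 ha, rfl⟩
  rw [← Finset.card_map, this, Nat.card_Ico, add_mul]; omega

/-- The position of `j` in the increasing enumeration of `A`. -/
def rank {n : ℕ} (A : Finset (Fin n)) (j : Fin n) : ℕ := (A.filter (· < j)).card

lemma rank_lt {n : ℕ} {A : Finset (Fin n)} {j : Fin n} (hj : j ∈ A) : rank A j < A.card :=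
  Finset.card_lt_card (Finset.filter_ssubset.2 ⟨j, hj, lt_irrefl j⟩)

lemma rank_strictMono {n : ℕ} {A : Finset (Fin n)} {j j' : Fin n} (hj : j ∈ A) (h : j < j') :
    rank A j < rank A j' := by
  apply Finset.card_lt_card
  refine Finset.ssubset_iff_subset_ne.2 ⟨fun a ha => ?_, fun e => ?_⟩
  · simp only [Finset.mem_filter] at ha ⊢
    exact ⟨ha.1, ha.2.trans h⟩
  · have : j ∈ A.filter (· < j) := by rw [e]; simp [hj, h]
    simp at this

lemma rank_injOn {n : ℕ} {A : Finset (Fin n)} {j j' : Fin n} (hj : j ∈ A) (hj' : j' ∈ A)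
    (h : rank A j = rank A j') : j = j' := by
  rcases lt_trichotomy j j' with h1 | h1 | h1
  · exact absurd h (rank_strictMono hj h1).ne
  · exact h1
  · exact absurd h (rank_strictMono hj' h1).ne'

/-! ### Concavity of the speed-up functions -/

namespace Input

variable {m n : ℕ} (I : Input m n)

/-- For y ≤ x monotonicity suffices; for y > x, concavity and a nonnegative value at 0 make the rate
per machine non-increasing. The sum of the two bounds covers both cases. -/
lemma speedup_le_mul (j : Fin n) {x y : ℝ} (hx : 0 < x) (hy : 0 ≤ y) :
    I.speedup j y ≤ I.speedup j x * (1 + y / x) := by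
  have fx := I.speedup_nonneg j x hx.le
  have hyx : 0 ≤ y / x := by positivity
  rcases le_or_gt y x with h | h
  · have := I.speedup_mono j hy hx.le h
    nlinarith
  · have hy' : 0 < y := hx.trans h
    have f0 := I.speedup_nonneg j 0 le_rfl
    have hxy : x / y ≤ 1 := (div_le_one hy').2 h.le
    have hc := (I.speedup_concave j).2 (Set.mem_Ici.2 hy) (Set.mem_Ici.2 le_rfl)
      (show 0 ≤ x / y by positivity) (show 0 ≤ 1 - x / y by linarith) (by ring)
    simp only [smul_eq_mul, mul_zero, add_zero] at hc
    rw [div_mul_cancel₀ _ hy'.ne'] at hc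
    have h1 : x / y * I.speedup j y ≤ I.speedup j x := by nlinarith
    have h2 : I.speedup j y ≤ I.speedup j x * (y / x) := by
      have := mul_le_mul_of_nonneg_right h1 hyx
      calc I.speedup j y = x / y * I.speedup j y * (y / x) := by field_simp
        _ ≤ _ := this
    nlinarith

/-- Time sharing realises the speed-up function at the average share. -/
lemma speedup_share (hm : 0 < m) (j : Fin n) (N : ℕ) :
    I.speedup j (machinesPerJob m N) + (slots m N - 1) * I.speedup j 0 =
      slots m N * I.speedup j (share m N) := by
  have hH : (0 : ℝ) < slots m N := by exact_mod_cast slots_pos m N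
  have hH1 : (1 : ℝ) ≤ slots m N := by exact_mod_cast slots_pos m N
  unfold share
  -- Either the job alternates between 0 and 1 machine, where the speed-up function is affine, or
  -- there is one slot and nothing to average. The value at 0 may be positive, so idle slots count.
  rcases machinesPerJob_eq_one_or_slots_eq_one hm N with h | h
  · rw [h]
    obtain ⟨a, b, hab⟩ := I.speedup_affine j 0
    simp only [Nat.cast_zero, zero_add] at hab
    have : ((1 : ℕ) : ℝ) / slots m N ∈ Set.Icc (0 : ℝ) 1 :=
      ⟨by positivity, by rw [Nat.cast_one]; exact (div_le_one hH).2 hH1⟩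
    rw [hab _ this, Nat.cast_one, hab 1 (by simp), hab 0 (by simp)]
    field_simp
    ring
  · rw [h]; simp

/-! ### Geometric epochs -/

/-- The length of the initial epoch: so short that no job can receive half of its predicted
processing requirement. -/
noncomputable def unit : ℝ := (1 + ∑ j, 2 * I.speedup j m / I.pred j)⁻¹

lemma unit_aux (j : Fin n) : 0 ≤ 2 * I.speedup j m / I.pred j :=
  div_nonneg (mul_nonneg zero_le_two (I.speedup_nonneg j _ (Nat.cast_nonneg _))) (I.pred_pos j).le

lemma unit_pos : 0 < I.unit :=
  inv_pos.2 (add_pos_of_pos_of_nonneg one_pos (Finset.sum_nonneg fun j _ => I.unit_aux j))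

lemma unit_mul_le (j : Fin n) : I.unit * I.speedup j m ≤ I.pred j / 2 := by
  have h1 : 2 * I.speedup j m / I.pred j ≤ 1 + ∑ j, 2 * I.speedup j m / I.pred j :=
    (Finset.single_le_sum (f := fun j => 2 * I.speedup j m / I.pred j)
      (fun j _ => I.unit_aux j) (Finset.mem_univ j)).trans (by linarith)
  have hp := I.pred_pos j
  have h0 : 0 < 1 + ∑ j, 2 * I.speedup j m / I.pred j :=
    add_pos_of_pos_of_nonneg one_pos (Finset.sum_nonneg fun j _ => I.unit_aux j)
  rw [div_le_iff₀ hp] at h1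
  unfold unit
  rw [inv_mul_le_iff₀ h0]
  linarith

/-- The start of epoch `k`. -/
noncomputable def start : ℕ → ℝ
  | 0 => 0
  | k + 1 => I.unit * 2 ^ k

/-- The length of epoch `k`. -/
noncomputable def len (k : ℕ) : ℝ := I.start (k + 1) - I.start k

lemma start_lt_succ (k : ℕ) : I.start k < I.start (k + 1) := by
  have := I.unit_pos
  cases k with
  | zero => simp [start, this]
  | succ k => simp only [start, pow_succ]; nlinarith [pow_pos (two_pos : (0 : ℝ) < 2) k]

lemma start_strictMono : StrictMono I.start := strictMono_nat_of_lt_succ I.start_lt_succ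

lemma start_nonneg (k : ℕ) : 0 ≤ I.start k := I.start_strictMono.monotone (Nat.zero_le k)

lemma len_pos (k : ℕ) : 0 < I.len k := sub_pos.2 (I.start_lt_succ k)

lemma start_add_len (k : ℕ) : I.start k + I.len k = I.start (k + 1) := by unfold len; ring

lemma start_succ_succ (k : ℕ) : I.start (k + 2) = 2 * I.start (k + 1) := by
  simp only [start, pow_succ]; ring

lemma exists_lt_start (t : ℝ) : ∃ k, t < I.start (k + 1) := by
  obtain ⟨k, hk⟩ := pow_unbounded_of_one_lt (t / I.unit) (one_lt_two (α := ℝ))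
  exact ⟨k, by rw [div_lt_iff₀ I.unit_pos] at hk; simpa [start, mul_comm] using hk⟩

/-- The epoch that contains time `t`. -/
noncomputable def epoch (t : ℝ) : ℕ := Nat.size ⌊t / I.unit⌋₊

/-- The epoch index is the number of binary digits of ⌊t / unit⌋, which is at most k exactly when
that floor is below 2 ^ k. -/
lemma epoch_le_iff {t : ℝ} {k : ℕ} : I.epoch t ≤ k ↔ t < I.start (k + 1) := by
  rw [epoch, Nat.size_le, Nat.floor_lt' (by positivity), div_lt_iff₀ I.unit_pos]
  simp [start, mul_comm]

lemma le_epoch_iff {t : ℝ} (ht : 0 ≤ t) {k : ℕ} : k ≤ I.epoch t ↔ I.start k ≤ t := by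
  cases k with
  | zero => simp [start, ht]
  | succ k => rw [Nat.succ_le_iff, ← not_le, I.epoch_le_iff, not_lt]

lemma epoch_eq {t : ℝ} {k : ℕ} (h1 : I.start k ≤ t) (h2 : t < I.start (k + 1)) :
    I.epoch t = k :=
  le_antisymm (I.epoch_le_iff.2 h2) ((I.le_epoch_iff ((I.start_nonneg k).trans h1)).2 h1)

lemma measurable_epoch : Measurable I.epoch :=
  (measurable_from_nat (f := Nat.size)).comp
    (Nat.measurable_floor.comp (measurable_id.div_const _))

end Input

/-! ### The algorithm and its schedule -/

/-- What the scheduler knows at the start of an epoch. -/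
structure State (n : ℕ) where
  /-- the jobs that have not been completed -/
  alive : Finset (Fin n)
  /-- the processing that each job would have received at its average share -/
  ideal : Fin n → ℝ
  /-- the processing that each job has received -/
  done : Fin n → ℝ

namespace Input

variable {m n : ℕ} (I : Input m n) (p : Fin n → ℝ)

/-- The ideal amount of processing at the end of epoch `k`. -/
noncomputable def nextIdeal (k : ℕ) (s : State n) (j : Fin n) : ℝ :=
  s.ideal j + I.len k * I.speedup j (share m s.alive.card)

/-- The jobs that run during epoch `k`: those alive whose ideal amount of processing exceeds half
of the prediction by the end of the epoch. -/
noncomputable def active (k : ℕ) (s : State n) : Finset (Fin n) :=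
  s.alive.filter fun j => I.pred j / 2 < I.nextIdeal k s j

/-- The amount of processing received by the end of epoch `k`. -/
noncomputable def nextDone (k : ℕ) (s : State n) (j : Fin n) : ℝ :=
  s.done j + I.len k * I.speedup j (if j ∈ I.active k s then share m s.alive.card else 0)

/-- The state at the start of epoch `k`. -/
noncomputable def state : ℕ → State n
  | 0 => ⟨Finset.univ, 0, 0⟩
  | k + 1 => ⟨Finset.univ.filter fun j => I.nextDone k (state k) j < p j,
      I.nextIdeal k (state k), I.nextDone k (state k)⟩

/-- Job `j` occupies machine `i` in slot `h` of epoch `k`. -/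
def Occupies (k : ℕ) (s : State n) (h : ℕ) (i : Fin m) (j : Fin n) : Prop :=
  j ∈ I.active k s ∧ rank s.alive j / m = h ∧
    (i : ℕ) / machinesPerJob m s.alive.card = rank s.alive j % m

open Classical in
/-- The job on machine `i` in slot `h` of epoch `k`. -/
noncomputable def occupant (k : ℕ) (s : State n) (h : ℕ) (i : Fin m) : Option (Fin n) :=
  if hx : ∃ j, I.Occupies k s h i j then some hx.choose else none

lemma Occupies.eq {I : Input m n} {k : ℕ} {s : State n} {h : ℕ} {i : Fin m} {j j' : Fin n}
    (h1 : I.Occupies k s h i j) (h2 : I.Occupies k s h i j') : j = j' := by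
  refine rank_injOn (Finset.mem_filter.1 h1.1).1 (Finset.mem_filter.1 h2.1).1 ?_
  rw [← Nat.div_add_mod (rank s.alive j) m, ← Nat.div_add_mod (rank s.alive j') m,
    h1.2.1, h2.2.1, ← h1.2.2, ← h2.2.2]

lemma occupant_eq_some_iff {k : ℕ} {s : State n} {h : ℕ} {i : Fin m} {j : Fin n} :
    I.occupant k s h i = some j ↔ I.Occupies k s h i j := by
  unfold occupant
  split_ifs with hx
  · rw [Option.some_inj]
    exact ⟨fun e => e ▸ hx.choose_spec, fun hj => hx.choose_spec.eq hj⟩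
  · simp only [false_iff]
    exact fun hj => hx ⟨j, hj⟩

lemma mem_active {k : ℕ} {s : State n} {j : Fin n} :
    j ∈ I.active k s ↔ j ∈ s.alive ∧ I.pred j / 2 < I.nextIdeal k s j := Finset.mem_filter

/-- The length of a slot in epoch `k`. -/
noncomputable def slotLen (k : ℕ) (s : State n) : ℝ := I.len k / slots m s.alive.card

lemma slotLen_pos (k : ℕ) (s : State n) : 0 < I.slotLen k s :=
  div_pos (I.len_pos k) (Nat.cast_pos.2 (slots_pos _ _))

lemma slots_mul_slotLen (k : ℕ) (s : State n) : slots m s.alive.card * I.slotLen k s = I.len k :=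
  mul_div_cancel₀ _ (Nat.cast_ne_zero.2 (slots_pos _ _).ne')

/-- The start of slot `h` of epoch `k`. -/
noncomputable def slotStart (k : ℕ) (s : State n) (h : ℕ) : ℝ := I.start k + h * I.slotLen k s

lemma slotStart_lt_succ (k : ℕ) (s : State n) (h : ℕ) :
    I.slotStart k s h < I.slotStart k s (h + 1) := by
  have := I.slotLen_pos k s
  unfold slotStart; push_cast; linarith

lemma start_le_slotStart (k : ℕ) (s : State n) (h : ℕ) : I.start k ≤ I.slotStart k s h :=
  le_add_of_nonneg_right (mul_nonneg (Nat.cast_nonneg _) (I.slotLen_pos k s).le)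

lemma slotStart_zero (k : ℕ) (s : State n) : I.slotStart k s 0 = I.start k := by simp [slotStart]

lemma slotStart_slots (k : ℕ) (s : State n) :
    I.slotStart k s (slots m s.alive.card) = I.start (k + 1) := by
  rw [slotStart, slots_mul_slotLen, start_add_len]

lemma slotStart_le {k : ℕ} {s : State n} {h : ℕ} (hh : h ≤ slots m s.alive.card) :
    I.slotStart k s h ≤ I.start (k + 1) := by
  rw [← I.slotStart_slots k s]
  unfold slotStart
  have := I.slotLen_pos k s
  gcongr

/-- The assignment of the machines at time `t`. -/
noncomputable def assign (t : ℝ) : Fin m → Option (Fin n) :=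
  I.occupant (I.epoch t) (I.state p (I.epoch t))
    ⌊(t - I.start (I.epoch t)) / I.slotLen (I.epoch t) (I.state p (I.epoch t))⌋₊

variable {p}

lemma assign_eq {k h : ℕ} {t : ℝ} (hh : h < slots m (I.state p k).alive.card)
    (h1 : I.slotStart k (I.state p k) h ≤ t) (h2 : t < I.slotStart k (I.state p k) (h + 1)) :
    I.assign p t = I.occupant k (I.state p k) h := by
  have hL := I.slotLen_pos k (I.state p k)
  have he : I.epoch t = k :=
    I.epoch_eq ((I.start_le_slotStart _ _ _).trans h1) (h2.trans_le (I.slotStart_le hh))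
  have hf : ⌊(t - I.start k) / I.slotLen k (I.state p k)⌋₊ = h := by
    unfold slotStart at h1 h2
    push_cast at h2
    rw [Nat.floor_eq_iff (div_nonneg (by nlinarith [(Nat.cast_nonneg h : (0 : ℝ) ≤ h)]) hL.le),
      le_div_iff₀ hL, div_lt_iff₀ hL]
    constructor <;> linarith
  rw [assign, he, hf]

variable (p)

lemma exists_slot_right {t : ℝ} (ht : 0 ≤ t) : ∃ k h, h < slots m (I.state p k).alive.card ∧
    I.slotStart k (I.state p k) h ≤ t ∧ t < I.slotStart k (I.state p k) (h + 1) := by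
  have h1 : I.start (I.epoch t) ≤ t := (I.le_epoch_iff ht).1 le_rfl
  have h2 : t < I.start (I.epoch t + 1) := I.epoch_le_iff.1 le_rfl
  generalize I.epoch t = k at h1 h2
  have hL := I.slotLen_pos k (I.state p k)
  have hx : 0 ≤ (t - I.start k) / I.slotLen k (I.state p k) :=
    div_nonneg (sub_nonneg.2 h1) hL.le
  have ha := Nat.floor_le hx
  have hb := Nat.lt_floor_add_one ((t - I.start k) / I.slotLen k (I.state p k))
  have hc : (t - I.start k) / I.slotLen k (I.state p k) < slots m (I.state p k).alive.card := by
    rw [div_lt_iff₀ hL, slots_mul_slotLen, len]; linarith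
  rw [le_div_iff₀ hL] at ha
  rw [div_lt_iff₀ hL] at hb
  refine ⟨k, _, (Nat.floor_lt hx).2 hc, ?_, ?_⟩
  · unfold slotStart; linarith
  · unfold slotStart; push_cast; linarith

/-- Slots closed on the right instead of the left: this one governs the left limit at t, where
interruptions are detected. -/
lemma exists_slot_left {t : ℝ} (ht : 0 < t) : ∃ k h, h < slots m (I.state p k).alive.card ∧
    I.slotStart k (I.state p k) h < t ∧ t ≤ I.slotStart k (I.state p k) (h + 1) := by
  obtain ⟨k, h1, h2⟩ : ∃ k, I.start k < t ∧ t ≤ I.start (k + 1) := by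
    classical
    have hex : ∃ k, t ≤ I.start (k + 1) := (I.exists_lt_start t).imp fun _ h => h.le
    refine ⟨Nat.find hex, ?_, Nat.find_spec hex⟩
    rcases hk : Nat.find hex with _ | k
    · exact ht
    · exact not_le.1 (Nat.find_min hex (m := k) (by omega))
  have hL := I.slotLen_pos k (I.state p k)
  have hx : 0 < (t - I.start k) / I.slotLen k (I.state p k) := div_pos (sub_pos.2 h1) hL
  obtain ⟨h, hh⟩ := Nat.exists_eq_succ_of_ne_zero (Nat.ceil_pos.2 hx).ne'
  have ha := Nat.le_ceil ((t - I.start k) / I.slotLen k (I.state p k))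
  have hb : (h : ℝ) < (t - I.start k) / I.slotLen k (I.state p k) :=
    Nat.lt_ceil.1 (by rw [hh]; exact Nat.lt_succ_self h)
  have hc : (t - I.start k) / I.slotLen k (I.state p k) ≤ slots m (I.state p k).alive.card := by
    rw [div_le_iff₀ hL, slots_mul_slotLen, len]; linarith
  have hd := Nat.ceil_le.2 hc
  rw [hh] at ha hd
  rw [div_le_iff₀ hL] at ha
  rw [lt_div_iff₀ hL] at hb
  refine ⟨k, h, hd, ?_, ?_⟩
  · unfold slotStart; linarith
  · push_cast at ha; unfold slotStart; push_cast; linarith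

/-- The schedule of the algorithm. -/
noncomputable def schedule : Schedule m n where
  assign := I.assign p
  right_const t ht := by
    obtain ⟨k, h, hh, h1, h2⟩ := I.exists_slot_right p ht
    filter_upwards [Ico_mem_nhdsGT h2] with s hs
    rw [I.assign_eq hh h1 h2, I.assign_eq hh (h1.trans hs.1) hs.2]
  left_const t ht := by
    obtain ⟨k, h, hh, h1, h2⟩ := I.exists_slot_left p ht
    refine ⟨I.occupant k (I.state p k) h, ?_⟩
    filter_upwards [Ioo_mem_nhdsLT h1] with s hs
    exact I.assign_eq hh hs.1.le (hs.2.trans_le h2)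

/-! ### Bounds on the ideal amount of processing -/

lemma mem_alive_succ {k : ℕ} {j : Fin n} :
    j ∈ (I.state p (k + 1)).alive ↔ (I.state p (k + 1)).done j < p j := by
  simp [state]

lemma speedup_share_nonneg (j : Fin n) (N : ℕ) : 0 ≤ I.speedup j (share m N) :=
  I.speedup_nonneg j _ (share_pos m N).le

lemma ideal_succ (k : ℕ) (j : Fin n) : (I.state p (k + 1)).ideal j = (I.state p k).ideal j +
    I.len k * I.speedup j (share m (I.state p k).alive.card) := rfl

lemma done_succ (k : ℕ) (j : Fin n) : (I.state p (k + 1)).done j = (I.state p k).done j +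
    I.len k * I.speedup j
      (if j ∈ I.active k (I.state p k) then share m (I.state p k).alive.card else 0) := rfl

lemma done_mono (j : Fin n) : Monotone fun k => (I.state p k).done j := by
  refine monotone_nat_of_le_succ fun k => ?_
  simp only [done_succ]
  refine le_add_of_nonneg_right (mul_nonneg (I.len_pos k).le (I.speedup_nonneg j _ ?_))
  split_ifs
  · exact (share_pos _ _).le
  · exact le_rfl

variable {p}

lemma alive_antitone : Antitone fun k => (I.state p k).alive := by
  refine antitone_nat_of_succ_le fun k j hj => ?_
  cases k with
  | zero => simp [state]
  | succ k =>
    simp only [mem_alive_succ] at hj ⊢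
    exact (I.done_mono p j (Nat.le_succ _)).trans_lt hj

lemma share_mono {k l : ℕ} (h : k ≤ l) :
    share m (I.state p k).alive.card ≤ share m (I.state p l).alive.card :=
  share_antitone m (Finset.card_le_card (I.alive_antitone h))

lemma speedup_share_mono (j : Fin n) {k l : ℕ} (h : k ≤ l) :
    I.speedup j (share m (I.state p k).alive.card) ≤
      I.speedup j (share m (I.state p l).alive.card) :=
  I.speedup_mono j (share_pos _ _).le (share_pos _ _).le (I.share_mono h)

variable (p) in
lemma ideal_mono (j : Fin n) : Monotone fun k => (I.state p k).ideal j := by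
  refine monotone_nat_of_le_succ fun k => ?_
  simp only [ideal_succ]
  exact le_add_of_nonneg_right (mul_nonneg (I.len_pos k).le (I.speedup_share_nonneg j _))

lemma ideal_le (j : Fin n) (k : ℕ) : (I.state p k).ideal j ≤
    I.start k * I.speedup j (share m (I.state p k).alive.card) := by
  induction k with
  | zero => simp [state, start]
  | succ k ih =>
    have h := I.speedup_share_mono (p := p) j (Nat.le_succ k)
    rw [ideal_succ, ← I.start_add_len k]
    have := I.start_nonneg k
    have := I.len_pos k
    have h2 := mul_le_mul_of_nonneg_left h (add_pos_of_nonneg_of_pos ‹0 ≤ I.start k› this).le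
    simp only [Nat.succ_eq_add_one] at h2
    linarith

lemma le_ideal (j : Fin n) {i k : ℕ} (h : i ≤ k) :
    (I.start k - I.start i) * I.speedup j (share m (I.state p i).alive.card) ≤
      (I.state p k).ideal j := by
  induction k, h using Nat.le_induction with
  | base =>
    rw [sub_self, zero_mul]
    exact I.ideal_mono p j (Nat.zero_le i)
  | succ k h ih =>
    have h1 := I.speedup_share_mono (p := p) j h
    have h2 := mul_le_mul_of_nonneg_left h1 (I.len_pos k).le
    rw [ideal_succ, ← I.start_add_len k]
    linarith

/-- From epoch 1 on, an epoch is as long as all time before it, and its share is at least every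
earlier share, so it adds at least the ideal amount accumulated so far. -/
lemma two_mul_ideal_le (j : Fin n) (k : ℕ) :
    2 * (I.state p (k + 1)).ideal j ≤ (I.state p (k + 2)).ideal j := by
  have h := I.ideal_le (p := p) j (k + 1)
  have hl : I.len (k + 1) = I.start (k + 1) := by rw [len, start_succ_succ]; ring
  rw [ideal_succ I p (k + 1), hl]
  linarith

lemma two_pow_mul_ideal_le (j : Fin n) (k i : ℕ) :
    2 ^ i * (I.state p (k + 1)).ideal j ≤ (I.state p (k + 1 + i)).ideal j := by
  induction i with
  | zero => simp
  | succ i ih =>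
    have := I.two_mul_ideal_le (p := p) j (k + i)
    rw [show k + i + 1 = k + 1 + i by ring, show k + i + 2 = k + 1 + (i + 1) by ring] at this
    rw [pow_succ]
    linarith

/-- In an active epoch both amounts grow equally; after an inactive one the ideal amount is still at
most `pred / 2`. -/
lemma ideal_succ_le_done (j : Fin n) {k : ℕ} (hj : j ∈ (I.state p k).alive) :
    (I.state p (k + 1)).ideal j ≤ (I.state p (k + 1)).done j + I.pred j / 2 := by
  induction k with
  | zero =>
    rw [done_succ]
    split_ifs with h
    · rw [ideal_succ]
      have : (I.state p 0).ideal j = (I.state p 0).done j := rfl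
      have := I.pred_pos j
      linarith
    · rw [mem_active, not_and, not_lt] at h
      have h1 := h hj
      have h2 : 0 ≤ (I.state p 1).done j := I.done_mono p j (Nat.zero_le 1)
      rw [done_succ, if_neg (by rw [mem_active, not_and, not_lt]; exact h)] at h2
      exact h1.trans (le_add_of_nonneg_left h2)
  | succ k ih =>
    have ih := ih (I.alive_antitone (Nat.le_succ k) hj)
    by_cases h : j ∈ I.active (k + 1) (I.state p (k + 1))
    · rw [done_succ, if_pos h, ideal_succ]
      linarith
    · have h' := h
      rw [mem_active, not_and, not_lt] at h'
      have h1 := h' hj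
      have h2 : 0 ≤ (I.state p (k + 1 + 1)).done j := I.done_mono p j (Nat.zero_le _)
      exact h1.trans (le_add_of_nonneg_left h2)

lemma ideal_le_of_mem_alive (hp : I.Underpredicted p) {j : Fin n} {k : ℕ}
    (hj : j ∈ (I.state p k).alive) : (I.state p k).ideal j ≤ 3 / 2 * p j := by
  have h0 := I.pred_pos j
  have h1 := hp j
  cases k with
  | zero => simp only [state, Pi.zero_apply]; linarith
  | succ k =>
    have h2 := I.ideal_succ_le_done j (I.alive_antitone (Nat.le_succ k) hj)
    rw [mem_alive_succ] at hj
    linarith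

lemma active_zero (hm : 0 < m) : I.active 0 (I.state p 0) = ∅ := by
  refine Finset.eq_empty_of_forall_notMem fun j hj => ?_
  rw [mem_active] at hj
  have h1 := I.unit_mul_le j
  have h2 : I.speedup j (share m (I.state p 0).alive.card) ≤ I.speedup j m :=
    I.speedup_mono j (share_pos _ _).le (Set.mem_Ici.2 (Nat.cast_nonneg m)) (share_le hm _)
  have h3 := mul_le_mul_of_nonneg_left h2 I.unit_pos.le
  have h4 : I.nextIdeal 0 (I.state p 0) j =
      I.unit * I.speedup j (share m (I.state p 0).alive.card) := by
    simp [nextIdeal, state, len, start]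
  linarith [hj.2]

/-- Puts the last epoch in which a job is alive at index 1 or later, where consecutive starts differ
by exactly a factor 2. -/
lemma mem_alive_one (hm : 0 < m) (hp : I.Underpredicted p) (j : Fin n) :
    j ∈ (I.state p 1).alive := by
  have h0 := I.pred_pos j
  have h1 := I.unit_mul_le j
  have h2 : I.speedup j 0 ≤ I.speedup j m :=
    I.speedup_mono j (Set.mem_Ici.2 le_rfl) (Set.mem_Ici.2 (Nat.cast_nonneg m))
      (Nat.cast_nonneg m)
  have h3 := mul_le_mul_of_nonneg_left h2 I.unit_pos.le
  rw [mem_alive_succ, done_succ, I.active_zero hm]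
  have : I.len 0 = I.unit := by simp [len, start]
  simp only [Finset.notMem_empty, if_false, this]
  have : (I.state p 0).done j = 0 := rfl
  linarith [hp j]

/-! ### The number of preemptions -/

variable (p) in
/-- The epochs in which job `j` runs. -/
def activeEpochs (j : Fin n) : Set ℕ := {k | j ∈ I.active k (I.state p k)}

lemma activeEpochs_encard_le (hp : I.Underpredicted p) (j : Fin n) :
    ∃ c : ℕ, (I.activeEpochs p j).encard ≤ c ∧ (c : ℝ) ≤ 4 * (1 + Real.logb 2 (p j / I.pred j)) := by
  classical
  have hq := I.pred_pos j
  have hpj := hp j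
  have hr : 1 ≤ p j / I.pred j := (one_le_div hq).2 hpj
  have hlog : 0 ≤ Real.logb 2 (p j / I.pred j) := Real.logb_nonneg one_lt_two hr
  rcases (I.activeEpochs p j).eq_empty_or_nonempty with he | hne
  · exact ⟨0, by simp [he], by push_cast; linarith⟩
  let k₀ := sInf (I.activeEpochs p j)
  have hk₀ : k₀ ∈ I.activeEpochs p j := Nat.sInf_mem hne
  have hi : I.pred j / 2 < (I.state p (k₀ + 1)).ideal j := ((I.mem_active).1 hk₀).2
  let c := ⌊Real.logb 2 (p j / I.pred j)⌋₊
  -- An active epoch k₀ + 1 + i forces 2 ^ i · pred / 2 < 3p/2, so 2 ^ i < 3 · 2 ^ (c + 1) < 2 ^ (c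
  -- + 3).
  have hsub : I.activeEpochs p j ⊆ (Finset.Ico k₀ (k₀ + (c + 4)) : Finset ℕ) := by
    intro k hk
    have h1 : k₀ ≤ k := Nat.sInf_le hk
    simp only [Finset.coe_Ico, Set.mem_Ico]
    refine ⟨h1, ?_⟩
    by_contra! hlt
    obtain ⟨i, rfl⟩ := Nat.exists_eq_add_of_le (show k₀ + 1 ≤ k by omega)
    have h2 := I.ideal_le_of_mem_alive hp ((I.mem_active).1 hk).1
    have h3 := I.two_pow_mul_ideal_le (p := p) j k₀ i
    have h4 : (2 : ℝ) ^ (c + 3) ≤ 2 ^ i := pow_le_pow_right₀ one_le_two (by omega)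
    have h5 : p j / I.pred j < 2 ^ (c + 1) := by
      have := Nat.lt_floor_add_one (Real.logb 2 (p j / I.pred j))
      rw [Real.logb_lt_iff_lt_rpow one_lt_two (by linarith)] at this
      exact_mod_cast this
    rw [div_lt_iff₀ hq] at h5
    have h6 : (2 : ℝ) ^ i * (I.pred j / 2) < 2 ^ i * (I.state p (k₀ + 1)).ideal j := by gcongr
    have h7 : (2 : ℝ) ^ (c + 3) * (I.pred j / 2) ≤ 2 ^ i * (I.pred j / 2) := by gcongr
    have h8 : (2 : ℝ) ^ (c + 3) = 4 * 2 ^ (c + 1) := by ring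
    rw [h8] at h7
    nlinarith
  refine ⟨c + 4, ?_, ?_⟩
  · refine (Set.encard_le_encard hsub).trans ?_
    rw [Set.encard_coe_eq_coe_finsetCard, Nat.card_Ico]
    simp
  · have := Nat.floor_le hlog
    push_cast
    linarith

lemma machines_eq {k h : ℕ} {t : ℝ} (hh : h < slots m (I.state p k).alive.card)
    (h1 : I.slotStart k (I.state p k) h ≤ t) (h2 : t < I.slotStart k (I.state p k) (h + 1))
    (j : Fin n) :
    (I.schedule p).machines j t = {i | I.Occupies k (I.state p k) h i j} := by
  ext i
  change I.assign p t i = some j ↔ I.Occupies k (I.state p k) h i j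
  rw [I.assign_eq hh h1 h2, occupant_eq_some_iff]

/-- A job has one slot per active epoch and its machines are fixed within it, so only the end of
that slot can interrupt it. -/
lemma setOf_interrupted_subset (j : Fin n) :
    {t | 0 < t ∧ (I.schedule p).InterruptedAt j t} ⊆
      (fun k => I.slotStart k (I.state p k) (rank (I.state p k).alive j / m + 1)) ''
        I.activeEpochs p j := by
  rintro t ⟨ht, A, ⟨i, hi⟩, hA, hne⟩
  obtain ⟨k, h, hh, h1, h2⟩ := I.exists_slot_left p ht
  obtain ⟨s, hs, hs1⟩ := (hA.and (Ioo_mem_nhdsLT h1)).exists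
  rw [I.machines_eq hh hs1.1.le (hs1.2.trans_le h2)] at hs
  have hocc : I.Occupies k (I.state p k) h i j := by rw [← hs] at hi; exact hi
  refine ⟨k, hocc.1, ?_⟩
  simp only [hocc.2.1]
  refine le_antisymm (not_lt.1 fun hlt => hne ?_) h2
  rw [I.machines_eq hh h1.le hlt, hs]

lemma preemptions_le (hp : I.Underpredicted p) :
    ((I.preemptions p (I.schedule p) : ℕ∞) : ℝ≥0∞) ≤ ENNReal.ofReal (4 * I.benchmark p) := by
  choose c hc hc' using I.activeEpochs_encard_le hp
  have h1 : I.preemptions p (I.schedule p) ≤ ((∑ j, c j : ℕ) : ℕ∞) := by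
    rw [Nat.cast_sum]
    refine Finset.sum_le_sum fun j _ => ?_
    refine le_trans ?_ (hc j)
    refine (Set.encard_le_encard fun t ht => ?_).trans
      ((Set.encard_le_encard (I.setOf_interrupted_subset j)).trans (Set.encard_image_le _ _))
    exact ⟨ht.1, ht.2.2⟩
  refine (ENat.toENNReal_mono h1).trans ?_
  rw [ENat.toENNReal_coe, ← ENNReal.ofReal_natCast]
  refine ENNReal.ofReal_le_ofReal ?_
  rw [benchmark, Finset.mul_sum, Nat.cast_sum]
  exact Finset.sum_le_sum fun j _ => hc' j

/-! ### The amount of processing received -/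

lemma sum_alloc_eq (hm : 0 < m) {k h : ℕ} {t : ℝ} (hh : h < slots m (I.state p k).alive.card)
    (h1 : I.slotStart k (I.state p k) h ≤ t) (h2 : t < I.slotStart k (I.state p k) (h + 1))
    (j : Fin n) :
    ∑ i, (I.schedule p).alloc t i j =
      if j ∈ I.active k (I.state p k) ∧ rank (I.state p k).alive j / m = h then
        (machinesPerJob m (I.state p k).alive.card : ℝ) else 0 := by
  classical
  simp only [Schedule.alloc, schedule, I.assign_eq hh h1 h2, occupant_eq_some_iff]
  rw [Finset.sum_boole]
  split_ifs with hj
  · rw [Nat.cast_inj]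
    simp only [Occupies, hj, true_and]
    exact card_block (machinesPerJob_pos _ _) (block_le hm (rank_lt (I.mem_active.1 hj.1).1))
  · rw [Nat.cast_eq_zero, Finset.card_eq_zero, Finset.filter_eq_empty_iff]
    exact fun i _ ho => hj ⟨ho.1, ho.2.1⟩

variable (p) in
/-- The processing rate of job `j` at time `t`. -/
noncomputable def rate (j : Fin n) (t : ℝ) : ℝ := I.speedup j (∑ i, (I.schedule p).alloc t i j)

/-- The processing rate of job `j` in slot `h` of epoch `k`. -/
noncomputable def slotRate (k : ℕ) (s : State n) (j : Fin n) (h : ℕ) : ℝ :=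
  I.speedup j (if j ∈ I.active k s ∧ rank s.alive j / m = h then
    (machinesPerJob m s.alive.card : ℝ) else 0)

lemma rate_slot (hm : 0 < m) (j : Fin n) {k h : ℕ} (hh : h < slots m (I.state p k).alive.card) :
    IntervalIntegrable (I.rate p j) MeasureTheory.volume
      (I.slotStart k (I.state p k) h) (I.slotStart k (I.state p k) (h + 1)) ∧
    ∫ t in (I.slotStart k (I.state p k) h)..(I.slotStart k (I.state p k) (h + 1)), I.rate p j t =
      I.slotLen k (I.state p k) * I.slotRate k (I.state p k) j h := by
  have hlt := I.slotStart_lt_succ k (I.state p k) h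
  have he : Set.EqOn (fun _ => I.slotRate k (I.state p k) j h) (I.rate p j)
      (Set.Ioo (I.slotStart k (I.state p k) h) (I.slotStart k (I.state p k) (h + 1))) := by
    intro t ht
    simp only [rate, slotRate]
    rw [I.sum_alloc_eq hm hh ht.1.le ht.2]
  constructor
  · refine (intervalIntegrable_const (c := I.slotRate k (I.state p k) j h)).congr_uIoo ?_
    rwa [Set.uIoo_of_lt hlt]
  · rw [intervalIntegral.integral_of_le hlt.le, MeasureTheory.integral_Ioc_eq_integral_Ioo,
      ← MeasureTheory.setIntegral_congr_fun measurableSet_Ioo he,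
      ← MeasureTheory.integral_Ioc_eq_integral_Ioo, ← intervalIntegral.integral_of_le hlt.le,
      intervalIntegral.integral_const, smul_eq_mul]
    congr 1
    unfold slotStart; push_cast; ring

lemma sum_slotRate (hm : 0 < m) (j : Fin n) (k : ℕ) (s : State n) :
    ∑ h ∈ Finset.range (slots m s.alive.card), I.slotLen k s * I.slotRate k s j h =
      I.len k * I.speedup j (if j ∈ I.active k s then share m s.alive.card else 0) := by
  rw [← Finset.mul_sum]
  by_cases hj : j ∈ I.active k s
  · have hr : rank s.alive j / m ∈ Finset.range (slots m s.alive.card) :=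
      Finset.mem_range.2 (div_lt_slots (rank_lt (I.mem_active.1 hj).1))
    rw [← Finset.add_sum_erase _ _ hr]
    have h1 : ∀ h ∈ (Finset.range (slots m s.alive.card)).erase (rank s.alive j / m),
        I.slotRate k s j h = I.speedup j 0 := by
      intro h hh
      rw [slotRate, if_neg fun e => (Finset.mem_erase.1 hh).1 e.2.symm]
    rw [Finset.sum_congr rfl h1, Finset.sum_const, Finset.card_erase_of_mem hr,
      Finset.card_range, nsmul_eq_mul, Nat.cast_pred (slots_pos _ _), slotRate,
      if_pos ⟨hj, rfl⟩, I.speedup_share hm, if_pos hj, ← mul_assoc, mul_comm (I.slotLen k s),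
      I.slots_mul_slotLen]
  · simp only [slotRate, hj, false_and, if_false]
    rw [Finset.sum_const, Finset.card_range, nsmul_eq_mul, ← mul_assoc,
      mul_comm (I.slotLen k s), I.slots_mul_slotLen]

lemma rate_epoch (hm : 0 < m) (j : Fin n) (k : ℕ) :
    IntervalIntegrable (I.rate p j) MeasureTheory.volume (I.start k) (I.start (k + 1)) ∧
    ∫ t in (I.start k)..(I.start (k + 1)), I.rate p j t =
      I.len k * I.speedup j
        (if j ∈ I.active k (I.state p k) then share m (I.state p k).alive.card else 0) := by
  have h0 := I.slotStart_zero k (I.state p k)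
  have h1 := I.slotStart_slots k (I.state p k)
  constructor
  · have := IntervalIntegrable.trans_iterate (a := I.slotStart k (I.state p k))
      (n := slots m (I.state p k).alive.card) fun h hh => (I.rate_slot hm j hh).1
    rwa [h0, h1] at this
  · have := intervalIntegral.sum_integral_adjacent_intervals (a := I.slotStart k (I.state p k))
      (n := slots m (I.state p k).alive.card) fun h hh => (I.rate_slot hm j hh).1
    rw [h0, h1] at this
    rw [← this, ← I.sum_slotRate hm]
    exact Finset.sum_congr rfl fun h hh => (I.rate_slot hm j (Finset.mem_range.1 hh)).2

/-- The bookkeeping value `done` agrees with the real schedule at epoch boundaries, the only times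
when the algorithm consults completions. -/
lemma processed_start (hm : 0 < m) (j : Fin n) (k : ℕ) :
    I.processed (I.schedule p).alloc j (I.start k) = (I.state p k).done j := by
  have h := intervalIntegral.sum_integral_adjacent_intervals (a := I.start)
      (n := k) fun l _ => (I.rate_epoch (p := p) hm j l).1
  have h0 : I.start 0 = 0 := rfl
  rw [h0] at h
  change ∫ t in (0 : ℝ)..(I.start k), I.rate p j t = _
  rw [← h]
  clear h
  induction k with
  | zero => simp [state]
  | succ k ih => rw [Finset.sum_range_succ, ih, (I.rate_epoch hm j k).2, done_succ]

/-! ### The algorithm does not anticipate -/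

lemma state_eq (hm : 0 < m) {p' : Fin n → ℝ} {t : ℝ}
    (h : ∀ s ∈ Set.Icc 0 t, ∀ j, (p j ≤ I.processed (I.schedule p).alloc j s ↔
      p' j ≤ I.processed (I.schedule p').alloc j s)) {k : ℕ} (hk : I.start k ≤ t) :
    I.state p k = I.state p' k := by
  induction k with
  | zero => rfl
  | succ k ih =>
    have ih := ih ((I.start_lt_succ k).le.trans hk)
    have h1 := h _ ⟨I.start_nonneg (k + 1), hk⟩
    simp only [I.processed_start hm] at h1
    simp only [state, ih] at h1 ⊢
    congr 1
    refine Finset.filter_congr fun j _ => ?_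
    rw [← not_le, ← not_le, h1 j]

lemma assign_congr {p' : Fin n → ℝ} {t : ℝ} (ht : 0 ≤ t)
    (h : ∀ s ∈ Set.Icc 0 t, ∀ j, (p j ≤ I.processed (I.schedule p).alloc j s ↔
      p' j ≤ I.processed (I.schedule p').alloc j s)) :
    I.assign p t = I.assign p' t := by
  rcases Nat.eq_zero_or_pos m with rfl | hm
  · exact Subsingleton.elim _ _
  · rw [assign, assign, I.state_eq hm h ((I.le_epoch_iff ht).1 le_rfl)]

end Input

/-- The algorithm that allots geometrically growing shares of the machines. -/
noncomputable def geometricSharing : OnlineAlgorithm where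
  run I p := I.schedule p
  nonanticipating I _ _ _ _ _ ht h := I.assign_congr ht h

/-! ### Competitiveness -/

open MeasureTheory

lemma intervalIntegrable_of_measurable_of_bounded {f : ℝ → ℝ} (hf : Measurable f) {C : ℝ}
    (hC : ∀ x, |f x| ≤ C) (a b : ℝ) : IntervalIntegrable f volume a b :=
  (intervalIntegrable_const (c := C)).mono_fun' hf.aestronglyMeasurable
    (Filter.Eventually.of_forall hC)

lemma measurable_ite_lt (a c : ℝ) : Measurable fun x : ℝ => if x < a then c else 0 :=
  Measurable.ite measurableSet_Iio measurable_const measurable_const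

lemma intervalIntegrable_ite_lt (a c u v : ℝ) :
    IntervalIntegrable (fun x : ℝ => if x < a then c else 0) volume u v :=
  intervalIntegrable_of_measurable_of_bounded (measurable_ite_lt a c) (C := |c|)
    (fun x => by split_ifs <;> simp) u v

lemma integral_ite_lt_le {a c V : ℝ} (ha : 0 ≤ a) (hc : 0 ≤ c) (hV : 0 ≤ V) :
    ∫ x in (0 : ℝ)..V, (if x < a then c else 0) ≤ c * a := by
  have h1 : ∀ x, (if x < a then c else 0) ≤ c := fun x => by split_ifs <;> simp [hc]
  rcases le_total V a with h | h
  · calc _ ≤ ∫ _ in (0 : ℝ)..V, c := intervalIntegral.integral_mono_on hV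
          (intervalIntegrable_ite_lt _ _ _ _) intervalIntegrable_const fun x _ => h1 x
      _ = V * c := by simp
      _ ≤ c * a := by nlinarith
  · rw [← intervalIntegral.integral_add_adjacent_intervals
      (intervalIntegrable_ite_lt a c 0 a) (intervalIntegrable_ite_lt a c a V)]
    have h2 : ∫ x in a..V, (if x < a then c else 0) = 0 := by
      rw [intervalIntegral.integral_congr (g := fun _ => (0 : ℝ)), intervalIntegral.integral_zero]
      intro x hx
      rw [Set.uIcc_of_le h] at hx
      simp [not_lt.2 hx.1]
    rw [h2, add_zero]
    calc _ ≤ ∫ _ in (0 : ℝ)..a, c := intervalIntegral.integral_mono_on ha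
          (intervalIntegrable_ite_lt _ _ _ _) intervalIntegrable_const fun x _ => h1 x
      _ = c * a := by simp [mul_comm]

namespace FractionalSchedule

variable {m n : ℕ} (X : FractionalSchedule m n)

/-- The total amount of machines that job `j` holds at time `t`. -/
noncomputable def total (j : Fin n) (t : ℝ) : ℝ := ∑ i, X.alloc t i j

lemma total_nonneg (j : Fin n) (t : ℝ) : 0 ≤ X.total j t :=
  Finset.sum_nonneg fun i _ => X.nonneg t i j

lemma sum_total_le (t : ℝ) : ∑ j, X.total j t ≤ m := by
  unfold total
  rw [Finset.sum_comm]
  exact (Finset.sum_le_sum fun i _ => X.sum_le_one t i).trans (by simp)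

lemma total_le (j : Fin n) (t : ℝ) : X.total j t ≤ m :=
  (Finset.single_le_sum (f := fun j => X.total j t) (fun j _ => X.total_nonneg j t)
    (Finset.mem_univ j)).trans (X.sum_total_le t)

lemma measurable_total (j : Fin n) : Measurable (X.total j) :=
  Finset.measurable_fun_sum _ fun i _ => X.measurable i j

end FractionalSchedule

/-! ### Charging the offline schedule -/

namespace Input

variable {m n : ℕ} (I : Input m n) (p : Fin n → ℝ)

/-- The price of a machine at time `t` of the offline schedule. -/
noncomputable def price (t : ℝ) : ℝ := 2 * (I.state p (I.epoch (12 * t))).alive.card / m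

variable {p}

lemma price_nonneg (t : ℝ) : 0 ≤ I.price p t := by unfold price; positivity

lemma price_le (t : ℝ) : I.price p t ≤ 2 * n / m := by
  have h : ((I.state p (I.epoch (12 * t))).alive.card : ℝ) ≤ n := by
    exact_mod_cast (Finset.card_le_univ _).trans_eq (Fintype.card_fin n)
  unfold price
  gcongr

lemma measurable_price : Measurable (I.price p) :=
  (measurable_from_nat (f := fun k => 2 * ((I.state p k).alive.card : ℝ) / m)).comp
    (I.measurable_epoch.comp (measurable_id.const_mul 12))

lemma measurable_total_mul_price (X : FractionalSchedule m n) (j : Fin n) :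
    Measurable fun t => X.total j t * I.price p t :=
  (X.measurable_total j).mul I.measurable_price

lemma intervalIntegrable_total_mul_price (X : FractionalSchedule m n) (j : Fin n) (a b : ℝ) :
    IntervalIntegrable (fun t => X.total j t * I.price p t) volume a b := by
  refine intervalIntegrable_of_measurable_of_bounded (I.measurable_total_mul_price X j)
    (C := m * (2 * n / m)) (fun t => ?_) a b
  rw [abs_of_nonneg (mul_nonneg (X.total_nonneg j t) (I.price_nonneg t))]
  exact mul_le_mul (X.total_le j t) (I.price_le t) (I.price_nonneg t) (Nat.cast_nonneg m)

variable (p) in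
/-- What job `j` pays for its machines until time `t` of the offline schedule. -/
noncomputable def payment (X : FractionalSchedule m n) (j : Fin n) (t : ℝ) : ℝ :=
  ∫ s in (0 : ℝ)..t, X.total j s * I.price p s

lemma payment_nonneg (X : FractionalSchedule m n) (j : Fin n) {t : ℝ} (ht : 0 ≤ t) :
    0 ≤ I.payment p X j t :=
  intervalIntegral.integral_nonneg ht fun s _ =>
    mul_nonneg (X.total_nonneg j s) (I.price_nonneg s)

/-- A job that is still alive must be paid for by the offline schedule, in time or in machines. -/
lemma start_le_payment (hm : 0 < m) (hp : I.Underpredicted p) (X : FractionalSchedule m n)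
    {j : Fin n} {t : ℝ} (ht : 0 ≤ t) (hX : p j ≤ I.processed X.alloc j t) {k : ℕ}
    (hk : j ∈ (I.state p k).alive) :
    I.start k ≤ 27 / 2 * t + 3 / 2 * I.payment p X j t := by
  have hY := I.payment_nonneg (p := p) X j ht
  rcases le_or_gt (I.start k) (12 * t) with hle | hlt
  · linarith
  have ht12 : 0 ≤ 12 * t := by linarith
  set F := I.speedup j (share m (I.state p (I.epoch (12 * t))).alive.card) with hF
  have hF0 : 0 ≤ F := I.speedup_share_nonneg j _
  have hpos : 0 < p j := (I.pred_pos j).trans_le (hp j)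
  have hek : I.epoch (12 * t) ≤ k :=
    I.epoch_le_iff.2 (hlt.trans (I.start_lt_succ k))
  have hrate : ∀ s ∈ Set.Icc 0 t,
      I.speedup j (X.total j s) ≤ F * (1 + X.total j s * I.price p s) := by
    intro s hs
    have hes : I.epoch (12 * s) ≤ I.epoch (12 * t) :=
      I.epoch_le_iff.2 (lt_of_le_of_lt (by linarith [hs.2]) (I.epoch_le_iff.1 le_rfl))
    have hj : j ∈ (I.state p (I.epoch (12 * s))).alive := I.alive_antitone (hes.trans hek) hk
    have h1 := I.speedup_le_mul j (share_pos m (I.state p (I.epoch (12 * s))).alive.card)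
      (X.total_nonneg j s)
    have h2 := inv_share_le hm (Finset.card_pos.2 ⟨j, hj⟩)
    have h3 := I.speedup_share_mono (p := p) j hes
    have h4 : X.total j s / share m (I.state p (I.epoch (12 * s))).alive.card ≤
        X.total j s * I.price p s := by
      rw [div_eq_mul_one_div]
      exact mul_le_mul_of_nonneg_left h2 (X.total_nonneg j s)
    have h5 := mul_nonneg (X.total_nonneg j s) (I.price_nonneg (p := p) s)
    refine h1.trans ((mul_le_mul_of_nonneg_left (by linarith)
      (I.speedup_share_nonneg j _)).trans (mul_le_mul_of_nonneg_right h3 (by linarith)))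
  have hint : IntervalIntegrable (fun s => I.speedup j (X.total j s)) volume 0 t := by
    -- A non-integrable rate has integral 0 by convention, which cannot reach `p j > 0`.
    by_contra hn
    have : I.processed X.alloc j t = 0 := intervalIntegral.integral_undef hn
    linarith
  have hpay := I.intervalIntegrable_total_mul_price (p := p) X j 0 t
  have h1 : p j ≤ F * (t + I.payment p X j t) := by
    calc p j ≤ ∫ s in (0 : ℝ)..t, I.speedup j (X.total j s) := hX
      _ ≤ ∫ s in (0 : ℝ)..t, F * (1 + X.total j s * I.price p s) :=
        intervalIntegral.integral_mono_on ht hint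
          ((intervalIntegrable_const.add hpay).const_mul F) hrate
      _ = F * (t + I.payment p X j t) := by
        rw [intervalIntegral.integral_const_mul,
          intervalIntegral.integral_add intervalIntegrable_const hpay]
        simp [payment]
  have hFpos : 0 < F := by
    rcases hF0.eq_or_lt with h | h
    · rw [← h, zero_mul] at h1; linarith
    · exact h
  have h2 := I.le_ideal (p := p) j hek
  rw [← hF] at h2
  have h3 := I.ideal_le_of_mem_alive hp hk
  have h4 : I.start (I.epoch (12 * t)) ≤ 12 * t := (I.le_epoch_iff ht12).1 le_rfl
  -- Since time 12t the job's ideal rate has been at least F, yet its ideal amount is at most 3p/2.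
  have h5 : (I.start k - 12 * t) * F ≤ (3 / 2 * (t + I.payment p X j t)) * F := by
    nlinarith
  have h6 := le_of_mul_le_mul_right h5 hFpos
  linarith

lemma sum_payment_le (hm : 0 < m) (X : FractionalSchedule m n) {t : Fin n → ℝ}
    (ht : ∀ j, 0 ≤ t j) {k : Fin n → ℕ}
    (hk : ∀ j l, j ∈ (I.state p l).alive → l ≤ k j + 1) :
    ∑ j, I.payment p X j (t j) ≤ ∑ j, I.start (k j + 1) / 3 := by
  have hV : 0 ≤ ∑ j, t j := Finset.sum_nonneg fun j _ => ht j
  have hm' : (0 : ℝ) < m := Nat.cast_pos.2 hm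
  have hint := I.intervalIntegrable_total_mul_price (p := p) X
  have h2 : ∀ j : Fin n, IntervalIntegrable
      (fun s : ℝ => if s < I.start (k j + 1) / 6 then (2 : ℝ) else 0) volume 0 (∑ j, t j) :=
    fun j => intervalIntegrable_ite_lt _ _ _ _
  calc ∑ j, I.payment p X j (t j)
      ≤ ∑ j, ∫ s in (0 : ℝ)..(∑ j, t j), X.total j s * I.price p s := by
        refine Finset.sum_le_sum fun j _ => ?_
        refine intervalIntegral.integral_mono_interval le_rfl (ht j)
          (Finset.single_le_sum (fun j _ => ht j) (Finset.mem_univ j))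
          (Filter.Eventually.of_forall fun s => ?_) (hint j _ _)
        exact mul_nonneg (X.total_nonneg j s) (I.price_nonneg s)
    _ = ∫ s in (0 : ℝ)..(∑ j, t j), ∑ j, X.total j s * I.price p s :=
        (intervalIntegral.integral_finsetSum fun j _ => hint j _ _).symm
    _ ≤ ∫ s in (0 : ℝ)..(∑ j, t j), ∑ j, (if s < I.start (k j + 1) / 6 then (2 : ℝ) else 0) := by
        refine intervalIntegral.integral_mono_on hV
          (by simpa only [Finset.sum_fn] using (IntervalIntegrable.sum _ fun j _ => hint j _ _))
          (by simpa only [Finset.sum_fn] using (IntervalIntegrable.sum _ fun j _ => h2 j)) fun s hs => ?_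
        rw [← Finset.sum_mul]
        calc (∑ j, X.total j s) * I.price p s ≤ m * I.price p s :=
              mul_le_mul_of_nonneg_right (X.sum_total_le s) (I.price_nonneg s)
          _ = ∑ j, if j ∈ (I.state p (I.epoch (12 * s))).alive then (2 : ℝ) else 0 := by
              rw [price, mul_div_cancel₀ _ hm'.ne', Finset.sum_ite_mem, Finset.univ_inter,
                Finset.sum_const, nsmul_eq_mul, mul_comm]
          _ ≤ _ := by
              refine Finset.sum_le_sum fun j _ => ?_
              split_ifs with ha hb hb
              · exact le_rfl
              -- Alive in the epoch of 12s means 12s < start (k j + 2) = 2 · start (k j + 1), hence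
              -- the cutoff at one sixth.
              · have h3 := I.epoch_le_iff.1 (hk j _ ha)
                rw [start_succ_succ] at h3
                exact absurd (by linarith) hb
              · exact zero_le_two
              · exact le_rfl
    _ = ∑ j, ∫ s in (0 : ℝ)..(∑ j, t j), (if s < I.start (k j + 1) / 6 then (2 : ℝ) else 0) :=
        intervalIntegral.integral_finsetSum fun j _ => h2 j
    _ ≤ ∑ j, I.start (k j + 1) / 3 := by
        refine Finset.sum_le_sum fun j _ => ?_
        have h3 := I.start_nonneg (k j + 1)
        exact (integral_ite_lt_le (by linarith) zero_le_two hV).trans_eq (by ring)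

/-- The last epoch at whose start job `j` is alive. -/
lemma exists_last_epoch (hm : 0 < m) (hp : I.Underpredicted p) (X : FractionalSchedule m n)
    {j : Fin n} {t : ℝ} (ht : 0 ≤ t) (hX : p j ≤ I.processed X.alloc j t) :
    ∃ k, j ∈ (I.state p (k + 1)).alive ∧ ∀ l, j ∈ (I.state p l).alive → l ≤ k + 1 := by
  classical
  have hex : ∃ l, j ∉ (I.state p l).alive := by
    obtain ⟨l, hl⟩ := I.exists_lt_start (27 / 2 * t + 3 / 2 * I.payment p X j t)
    exact ⟨l + 1, fun h => hl.not_ge (I.start_le_payment hm hp X ht hX h)⟩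
  have h1 := Nat.find_spec hex
  have h2 : 2 ≤ Nat.find hex := by
    by_contra! h
    exact h1 (I.alive_antitone (show Nat.find hex ≤ 1 by omega) (I.mem_alive_one hm hp j))
  obtain ⟨k, hk⟩ := Nat.exists_eq_add_of_le h2
  refine ⟨k, not_not.1 (Nat.find_min hex (show k + 1 < Nat.find hex by omega)), fun l hl => ?_⟩
  by_contra! h
  exact h1 (I.alive_antitone (show Nat.find hex ≤ l by omega) hl)

lemma completionTime_le (hm : 0 < m) {j : Fin n} {k : ℕ} (h : j ∉ (I.state p (k + 1)).alive) :
    I.completionTime p (I.schedule p).alloc j ≤ ENNReal.ofReal (I.start (k + 1)) := by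
  rw [mem_alive_succ, not_lt] at h
  exact iInf₂_le _ ⟨I.start_nonneg _, (I.processed_start hm j (k + 1)).symm ▸ h⟩

lemma totalCompletionTime_le_of_processed (hm : 0 < m) (hp : I.Underpredicted p)
    (X : FractionalSchedule m n) {t : Fin n → ℝ} (ht : ∀ j, 0 ≤ t j)
    (hX : ∀ j, p j ≤ I.processed X.alloc j (t j)) :
    I.totalCompletionTime p (I.schedule p).alloc ≤ ENNReal.ofReal (54 * ∑ j, t j) := by
  choose k hk hk' using fun j => I.exists_last_epoch hm hp X (ht j) (hX j)
  have h1 := I.sum_payment_le hm X ht hk'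
  have h2 : ∑ j, I.start (k j + 1) ≤ ∑ j, (27 / 2 * t j + 3 / 2 * I.payment p X j (t j)) :=
    Finset.sum_le_sum fun j _ => I.start_le_payment hm hp X (ht j) (hX j) (hk j)
  rw [Finset.sum_add_distrib, ← Finset.mul_sum, ← Finset.mul_sum] at h2
  rw [← Finset.sum_div] at h1
  calc I.totalCompletionTime p (I.schedule p).alloc
      ≤ ∑ j, ENNReal.ofReal (I.start (k j + 2)) := by
        refine Finset.sum_le_sum fun j _ => I.completionTime_le hm fun h => ?_
        have := hk' j _ h
        omega
    _ = ENNReal.ofReal (2 * ∑ j, I.start (k j + 1)) := by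
        rw [← ENNReal.ofReal_sum_of_nonneg fun j _ => I.start_nonneg _, Finset.mul_sum]
        simp only [start_succ_succ]
    -- With S the sum of the starts and T that of the t j: S ≤ 27/2 · T + 3/2 · S/3, so 2S ≤ 54T.
    _ ≤ _ := ENNReal.ofReal_le_ofReal (by linarith)

lemma totalCompletionTime_le (hp : I.Underpredicted p) (X : FractionalSchedule m n) :
    I.totalCompletionTime p (I.schedule p).alloc ≤
      ENNReal.ofReal 54 * I.totalCompletionTime p X.alloc := by
  rcases Nat.eq_zero_or_pos m with rfl | hm
  · have h : (I.schedule p).alloc = X.alloc := by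
      funext t i; exact i.elim0
    rw [h]
    exact le_mul_of_one_le_left' (by simp)
  by_cases htop : ∃ j, I.completionTime p X.alloc j = ⊤
  · obtain ⟨j, hj⟩ := htop
    have : I.totalCompletionTime p X.alloc = ⊤ :=
      ENNReal.sum_eq_top.2 ⟨j, Finset.mem_univ j, hj⟩
    rw [this, ENNReal.mul_top (by simp)]
    exact le_top
  push Not at htop
  refine ENNReal.le_of_forall_pos_le_add fun η hη _ => ?_
  -- The infimum defining a completion time is only approximated, so each job gets slack δ; n + 1
  -- keeps the denominator usable for n = 0 too.
  set δ : ℝ≥0∞ := η / (54 * (n + 1)) with hδ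
  have hδ0 : δ ≠ 0 := by
    refine ENNReal.div_ne_zero.2 ⟨by simpa using hη.ne', ?_⟩
    exact ENNReal.mul_ne_top (by simp) (by simp)
  have hex : ∀ j, ∃ t : ℝ, 0 ≤ t ∧ p j ≤ I.processed X.alloc j t ∧
      ENNReal.ofReal t ≤ I.completionTime p X.alloc j + δ := by
    intro j
    have h := ENNReal.lt_add_right (htop j) hδ0
    obtain ⟨t, ht⟩ := iInf_lt_iff.1 h
    obtain ⟨ht1, ht2⟩ := iInf_lt_iff.1 ht
    exact ⟨t, ht1.1, ht1.2, ht2.le⟩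
  choose t ht hX hle using hex
  calc I.totalCompletionTime p (I.schedule p).alloc
      ≤ ENNReal.ofReal (54 * ∑ j, t j) := I.totalCompletionTime_le_of_processed hm hp X ht hX
    _ = ENNReal.ofReal 54 * ∑ j, ENNReal.ofReal (t j) := by
        rw [ENNReal.ofReal_mul (by norm_num), ENNReal.ofReal_sum_of_nonneg fun j _ => ht j]
    _ ≤ ENNReal.ofReal 54 * ∑ j, (I.completionTime p X.alloc j + δ) := by
        gcongr with j; exact hle j
    _ = ENNReal.ofReal 54 * I.totalCompletionTime p X.alloc + 54 * (n * δ) := by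
        rw [Finset.sum_add_distrib, mul_add, totalCompletionTime]
        simp
    _ ≤ ENNReal.ofReal 54 * I.totalCompletionTime p X.alloc + η := by
        gcongr
        calc 54 * (n * δ) ≤ (54 * (n + 1)) * δ := by
              rw [← mul_assoc]; gcongr; exact le_self_add
          _ ≤ η := ENNReal.mul_div_le

end Input

lemma geometricSharing_isCompetitive {c : ℝ} (hc : 54 ≤ c) :
    geometricSharing.IsCompetitive c := by
  intro m n I p hp
  have h : I.totalCompletionTime p (I.schedule p).alloc ≤ ENNReal.ofReal 54 * I.opt p := by
    rw [Input.opt, ENNReal.mul_iInf_of_ne (by simp) (by simp)]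
    exact le_iInf fun X => I.totalCompletionTime_le hp X
  exact h.trans (by gcongr)

end Malleable

theorem mainTheorem9 :
    ∃ K : ℝ, ∀ ε : ℝ, 0 < ε → ∃ A : Malleable.OnlineAlgorithm,
      A.IsCompetitive (54 * (1 + ε)) ∧
      ∀ (m n : ℕ) (I : Malleable.Input m n) (p : Fin n → ℝ), I.Underpredicted p →
        ((I.preemptions p (A.run I p) : ℕ∞) : ℝ≥0∞) ≤
          ENNReal.ofReal (K * max 1 (1 / ε ^ 2) * I.benchmark p) := by
  refine ⟨4, fun ε hε => ⟨Malleable.geometricSharing,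
    Malleable.geometricSharing_isCompetitive (by linarith), fun m n I p hp =>
    (I.preemptions_le hp).trans (ENNReal.ofReal_le_ofReal ?_)⟩⟩
  have hb : 0 ≤ I.benchmark p := Finset.sum_nonneg fun j _ =>
    add_nonneg zero_le_one (Real.logb_nonneg one_lt_two ((one_le_div (I.pred_pos j)).2 (hp j)))
  have h1 : (1 : ℝ) ≤ max 1 (1 / ε ^ 2) := le_max_left _ _
  gcongr
  linarith
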